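/- All graphs are finite and simple. For an integer $k\ge 1$, a graph $G$ is $k$-critical if every proper subgraph of $G$ is $(k-1)$-colorable but $G$ itself is not. The circumference of a graph is the length of a longest cycle in it, and for integers $k\ge 4$ and $n\ge k+2$ we denote by $L_k(n)$ the largest integer $l$ such that every $k$-critical graph on $n$ vertices has circumference at least $l$. **Theorem.** For every integer $k\ge 4$ and every integer $n\ge k+2$, every $k$-critical graph on $n$ vertices has a cycle of length at least $\dfrac{\log n}{100\log k}$. In other words, $$L_k(n)\;\ge\;\frac{\log n}{100\log k}.$$ -/

import Mathlib

namespace SimpleGraph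

/-- `G` is `k`-critical (used for `1 ≤ k`): every proper subgraph of `G` is `(k-1)`-colorable,
but `G` itself is not. Subgraphs may omit vertices as well as edges. -/
def IsCritical {V : Type*} (G : SimpleGraph V) (k : ℕ) : Prop :=
  (∀ H : G.Subgraph, H ≠ ⊤ → H.coe.Colorable (k - 1)) ∧ ¬ G.Colorable (k - 1)

/-- The circumference of `G`: the length of a longest cycle of `G`
(the supremum of all cycle lengths, which is `0` if there is no cycle). -/
noncomputable def circumference {V : Type*} (G : SimpleGraph V) : ℕ∞ :=
  ⨆ (v : V) (c : G.Walk v v) (_ : c.IsCycle), (c.length : ℕ∞)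

/-- `L_k(n)`: the largest `l` such that every `k`-critical graph on `n` vertices has
circumference at least `l`. -/
noncomputable def minCriticalCircumference (k n : ℕ) : ℕ∞ :=
  sSup {l : ℕ∞ | ∀ G : SimpleGraph (Fin n), G.IsCritical k → l ≤ G.circumference}

end SimpleGraph

/-!
A `k`-critical graph `G` with `k ≥ 3` is 2-connected. Let `ℓ` be the length of a longest cycle
through a fixed edge `xy`; then an `x`–`y` path has at most `ℓ` vertices.

*Treedepth.* `G` has treedepth at most `ℓ`. More generally, let `D` be connected with no vertex
of `D` separating another one from `X ∪ Y`, and suppose that all `X`–`Y` paths in `D` have at most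
`L` vertices; then `D` has treedepth at most `L`. Let `U` be the set of vertices of `D` that no
single vertex separates from `Y`. If `U = D`, remove a vertex `z` of `X` and apply induction to the
components of the rest, with `Y` and the neighbours of `z` as terminals. Otherwise each component
of `D \ U` is attached to `U` at a single vertex `b`. By induction, if `t` is the treedepth of `U`,
every `b ∈ U` starts a path in `U` to `Y` with at least `t` vertices, which extends the paths from
`X` to `b` through the component. So the components have treedepth at most `L - t`.

*Counting.* For each vertex `w` choose a `(k - 1)`-colouring of `G - w`. If two of these colourings
agree on the boundary of `D`, their omitted vertices cannot lie in different components of `D`: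
exchanging the colourings on one component would colour `G`. Recording the colour of the vertex
removed at each level of a treedepth decomposition therefore bounds the number of vertices of `G`
by `∑ i < ℓ, (k - 1) ^ i < (k - 1) ^ ℓ`.
-/

namespace CriticalGraph

open SimpleGraph

variable {V : Type*} {G : SimpleGraph V}

/-- `ReachIn G S u v`: some walk of `G` from `u` to `v` has all its vertices, including `u` and
`v`, in `S`. Unlike reachability in `G.induce S`, this does not need vertices of a subtype. -/
inductive ReachIn (G : SimpleGraph V) (S : Set V) : V → V → Prop
  | refl {u : V} (hu : u ∈ S) : ReachIn G S u u
  | cons {u v w : V} (hu : u ∈ S) (huv : G.Adj u v) (hvw : ReachIn G S v w) : ReachIn G S u w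

namespace ReachIn

variable {S T : Set V} {b u v w : V}

theorem left_mem (h : ReachIn G S u v) : u ∈ S := by
  cases h <;> assumption

theorem right_mem (h : ReachIn G S u v) : v ∈ S := by
  induction h <;> assumption

theorem trans (huv : ReachIn G S u v) (hvw : ReachIn G S v w) : ReachIn G S u w := by
  induction huv with
  | refl => exact hvw
  | cons hu hadj _ ih => exact .cons hu hadj (ih hvw)

theorem symm (h : ReachIn G S u v) : ReachIn G S v u := by
  induction h with
  | refl hu => exact .refl hu
  | cons hu hadj hvw ih => exact ih.trans (.cons hvw.left_mem hadj.symm (.refl hu))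

theorem mono (h : ReachIn G S u v) (hST : S ⊆ T) : ReachIn G T u v := by
  induction h with
  | refl hu => exact .refl (hST hu)
  | cons hu hadj _ ih => exact .cons (hST hu) hadj ih

theorem exists_isPath (h : ReachIn G S u v) :
    ∃ p : G.Walk u v, p.IsPath ∧ ∀ w ∈ p.support, w ∈ S := by
  classical
  obtain ⟨p, hp⟩ : ∃ p : G.Walk u v, ∀ w ∈ p.support, w ∈ S := by
    induction h with
    | refl hu => exact ⟨.nil, by simpa using hu⟩
    | cons hu hadj _ ih =>
      obtain ⟨p, hp⟩ := ih
      exact ⟨.cons hadj p, by simpa using ⟨hu, hp⟩⟩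
  exact ⟨p.bypass, p.bypass_isPath, fun w hw => hp w (p.support_bypass_subset_support hw)⟩

theorem avoids_or_exists_adj (h : ReachIn G S u v) (hub : u ≠ b) :
    ReachIn G (S \ {b}) u v ∨ ∃ a, G.Adj a b ∧ ReachIn G (S \ {b}) u a := by
  induction h with
  | refl hu => exact .inl (.refl ⟨hu, hub⟩)
  | @cons u c _ hu hadj _ ih =>
    by_cases hcb : c = b
    · exact .inr ⟨u, hcb ▸ hadj, .refl ⟨hu, hub⟩⟩
    · refine (ih hcb).imp (.cons ⟨hu, hub⟩ hadj) ?_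
      rintro ⟨a, hab, hca⟩
      exact ⟨a, hab, .cons ⟨hu, hub⟩ hadj hca⟩

theorem exists_adj (h : ReachIn G S u b) (hub : u ≠ b) :
    ∃ a, G.Adj a b ∧ ReachIn G (S \ {b}) u a :=
  (h.avoids_or_exists_adj hub).resolve_left fun h' => h'.right_mem.2 rfl

theorem reaches_first (h : ReachIn G S u v) (hbv : b ≠ v) :
    ReachIn G (S \ {b}) u v ∨ ReachIn G (S \ {v}) u b := by
  induction h with
  | refl hu => exact .inl (.refl ⟨hu, hbv.symm⟩)
  | @cons u c v hu hadj _ ih =>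
    by_cases hub : u = b
    · exact .inr (hub ▸ .refl ⟨hu, hub ▸ hbv⟩)
    by_cases huv : u = v
    · exact .inl (huv ▸ .refl ⟨hu, hub⟩)
    · exact (ih hbv).imp (.cons ⟨hu, hub⟩ hadj) (.cons ⟨hu, huv⟩ hadj)

end ReachIn

/-- The component of `v` in the subgraph of `G` induced on `S`; it is empty if `v ∉ S`. -/
def compIn (G : SimpleGraph V) (S : Set V) (v : V) : Set V :=
  {w | ReachIn G S v w}

section Components

variable {S T : Set V} {b u v w : V}

theorem compIn_subset : compIn G S v ⊆ S :=
  fun _ h => h.right_mem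

theorem compIn_mono (hST : S ⊆ T) : compIn G S v ⊆ compIn G T v :=
  fun _ h => h.mono hST

theorem compIn_sdiff_singleton_ssubset (hb : b ∈ S) : compIn G (S \ {b}) v ⊂ S :=
  ⟨compIn_subset.trans Set.sdiff_subset, fun h => (compIn_subset (h hb)).2 rfl⟩

theorem ReachIn.inter_compIn (h : ReachIn G T u w) (hTS : T ⊆ S) (hu : u ∈ compIn G S v) :
    ReachIn G (T ∩ compIn G S v) u w := by
  induction h with
  | refl huT => exact .refl ⟨huT, hu⟩
  | cons huT hadj hcw ih =>
    exact .cons ⟨huT, hu⟩ hadj (ih (hu.trans (.cons (hTS huT) hadj (.refl (hTS hcw.left_mem)))))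

end Components

/-- Every component of `S \ B` is adjacent to at most one vertex of `B`. -/
def UniqueAttachment (G : SimpleGraph V) (S B : Set V) : Prop :=
  ∀ ⦃b⦄, b ∈ B → ∀ ⦃b'⦄, b' ∈ B → ∀ ⦃u u'⦄, G.Adj b u → G.Adj b' u' →
    ReachIn G (S \ B) u u' → b = b'

namespace UniqueAttachment

variable {S S' B B' : Set V} {u v : V}

theorem mono (h : UniqueAttachment G S B) (hB : B' ⊆ B) (hS : S' \ B' ⊆ S \ B) :
    UniqueAttachment G S' B' :=
  fun _ hb _ hb' _ _ hbu hbu' huu' => h (hB hb) (hB hb') hbu hbu' (huu'.mono hS)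

/-- A walk ending in `B` can be pushed into `B`: its detours outside `B` return to the vertex where
they left. If the walk starts outside `B`, then the result starts where the walk enters `B`. -/
theorem exists_reachIn_inter (h : UniqueAttachment G S B) (huv : ReachIn G S u v) (hv : v ∈ B) :
    ∃ b ∈ B, ReachIn G (S ∩ B) b v ∧ (b = u ∨ ∃ a, G.Adj b a ∧ ReachIn G (S \ B) u a) := by
  induction huv with
  | refl hu => exact ⟨_, hv, .refl ⟨hu, hv⟩, .inl rfl⟩
  | @cons u c v hu hadj _ ih =>
    obtain ⟨b, hb, hbv, hbc⟩ := ih hv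
    by_cases huB : u ∈ B
    · refine ⟨u, huB, ?_, .inl rfl⟩
      rcases hbc with rfl | ⟨a, hba, hca⟩
      · exact .cons ⟨hu, huB⟩ hadj hbv
      · rwa [h huB hb hadj hba hca]
    · refine ⟨b, hb, hbv, .inr ?_⟩
      rcases hbc with rfl | ⟨a, hba, hca⟩
      · exact ⟨u, hadj.symm, .refl ⟨hu, huB⟩⟩
      · exact ⟨a, hba, .cons ⟨hu, huB⟩ hadj hca⟩

theorem reachIn_inter (h : UniqueAttachment G S B) (huv : ReachIn G S u v) (hu : u ∈ B)
    (hv : v ∈ B) : ReachIn G (S ∩ B) u v := by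
  obtain ⟨b, -, hbv, rfl | ⟨a, -, hua⟩⟩ := h.exists_reachIn_inter huv hv
  · exact hbv
  · exact absurd hu hua.left_mem.2

end UniqueAttachment

/-- The subgraph of `G` induced on `S` has treedepth at most `t`: a graph is handled component by
component, and removing a vertex costs one. The empty set is the case of `components` without any
component. -/
inductive TreeDepthLE (G : SimpleGraph V) : Set V → ℕ → Prop
  | components {S : Set V} {t : ℕ} (h : ∀ v ∈ S, TreeDepthLE G (compIn G S v) t) :
      TreeDepthLE G S t
  | remove {S : Set V} {t : ℕ} (v : V) (h : TreeDepthLE G (S \ {v}) t) : TreeDepthLE G S (t + 1)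

namespace TreeDepthLE

variable {S T B : Set V} {s t : ℕ}

theorem mono (h : TreeDepthLE G S s) (hTS : T ⊆ S) (hst : s ≤ t) : TreeDepthLE G T t := by
  induction h generalizing T t with
  | components _ ih => exact .components fun v hv => ih v (hTS hv) (compIn_mono hTS) hst
  | remove v _ ih =>
    obtain ⟨r, rfl⟩ := Nat.exists_eq_add_one_of_ne_zero (by omega : t ≠ 0)
    exact .remove v (ih (Set.sdiff_subset_sdiff_left hTS) (by omega))

/-- The decomposition of `B` is used first; since the components of `S \ B` are attached at single
vertices, it breaks up `S` in the same way as `B`. -/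
theorem attach (hB : TreeDepthLE G B t) (hatt : UniqueAttachment G S B)
    (hS : ∀ v ∈ S \ B, TreeDepthLE G (compIn G (S \ B) v) s) : TreeDepthLE G S (t + s) := by
  induction hB generalizing S with
  | @components B t _ ih =>
    refine .components fun x hx => ?_
    by_cases hmeet : ∃ b ∈ B, b ∈ compIn G S x
    · obtain ⟨b, hbB, hbx⟩ := hmeet
      have hsub : compIn G S x \ compIn G B b ⊆ S \ B := by
        rintro w ⟨hxw, hbw⟩
        refine ⟨hxw.right_mem, fun hwB => hbw ?_⟩
        exact (hatt.reachIn_inter (hbx.symm.trans hxw) hbB hwB).mono Set.inter_subset_right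
      exact ih b hbB (hatt.mono compIn_subset hsub) fun v hv =>
        (hS v (hsub hv)).mono (compIn_mono hsub) le_rfl
    · push Not at hmeet
      have hsub : compIn G S x ⊆ compIn G (S \ B) x := fun w hxw =>
        (hxw.inter_compIn subset_rfl (.refl hx)).mono fun a ha =>
          ⟨ha.1, fun haB => hmeet a haB ha.2⟩
      exact (hS x ⟨hx, fun hxB => hmeet x hxB (.refl hx)⟩).mono hsub (Nat.le_add_left s t)
  | @remove B t v _ ih =>
    have hsub : (S \ {v}) \ (B \ {v}) ⊆ S \ B := by grind
    rw [Nat.add_right_comm]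
    exact .remove v (ih (hatt.mono Set.sdiff_subset hsub) fun u hu =>
      (hS u (hsub hu)).mono (compIn_mono hsub) le_rfl)

end TreeDepthLE

/-- The vertices of `D` that `d` separates from `Y` within `D`. -/
def separatedBy (G : SimpleGraph V) (D Y : Set V) (d : V) : Set V :=
  {v ∈ D | v ≠ d ∧ ∀ y ∈ Y, ¬ ReachIn G (D \ {d}) v y}

/-- The vertices of `D` that no other vertex of `D` separates from `Y` within `D`. -/
def unseparated (G : SimpleGraph V) (D Y : Set V) : Set V :=
  {v ∈ D | ∀ d ∈ D, v ∉ separatedBy G D Y d}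

section Separation

variable {D X Y Z : Set V} {b d e u v : V}

theorem mem_unseparated_iff :
    v ∈ unseparated G D Y ↔ v ∈ D ∧ ∀ d ∈ D, v ≠ d → ∃ y ∈ Y, ReachIn G (D \ {d}) v y := by
  simp only [unseparated, separatedBy, Set.mem_ofPred_eq]
  grind

theorem unseparated_subset : unseparated G D Y ⊆ D :=
  fun _ hv => hv.1

theorem unseparated_mono (hYZ : Y ⊆ Z) : unseparated G D Y ⊆ unseparated G D Z := by
  intro v hv
  exact ⟨hv.1, fun d hd hsep => hv.2 d hd ⟨hsep.1, hsep.2.1, fun y hy => hsep.2.2 y (hYZ hy)⟩⟩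

theorem inter_subset_unseparated : Y ∩ D ⊆ unseparated G D Y := by
  intro y hy
  exact mem_unseparated_iff.2 ⟨hy.2, fun d _ hyd => ⟨y, hy.1, .refl ⟨hy.2, hyd⟩⟩⟩

theorem mem_separatedBy_of_reachIn (hu : u ∈ separatedBy G D Y d)
    (huv : ReachIn G (D \ {d}) u v) : v ∈ separatedBy G D Y d :=
  ⟨huv.right_mem.1, huv.right_mem.2, fun y hy hvy => hu.2.2 y hy (huv.trans hvy)⟩

theorem mem_unseparated_insert (hub : u ∈ separatedBy G D Y b)
    (hu : u ∈ unseparated G D (X ∪ Y)) : u ∈ unseparated G D (insert b X) := by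
  refine mem_unseparated_iff.2 ⟨hu.1, fun d hd hud => ?_⟩
  obtain ⟨z, hz | hz, huz⟩ := (mem_unseparated_iff.1 hu).2 d hd hud
  · exact ⟨z, .inr hz, huz⟩
  by_cases hbz : b = z
  · exact ⟨b, .inl rfl, hbz ▸ huz⟩
  rcases huz.reaches_first hbz with huz' | hub'
  · exact absurd (huz'.mono (Set.sdiff_subset_sdiff_left Set.sdiff_subset)) (hub.2.2 z hz)
  · exact ⟨b, .inl rfl, hub'.mono Set.sdiff_subset⟩

theorem separatedBy_ssubset (hconn : ∀ u ∈ D, ∀ v ∈ D, ReachIn G D u v) (hY : (Y ∩ D).Nonempty)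
    (hd : d ∈ separatedBy G D Y e) : separatedBy G D Y d ⊂ separatedBy G D Y e := by
  have he_notMem : e ∉ separatedBy G D Y d := by
    intro he
    obtain ⟨y, hyY, hyD⟩ := hY
    rcases (hconn y hyD d hd.1).reaches_first hd.2.1.symm with hyd | hye
    · exact hd.2.2 y hyY hyd.symm
    · exact he.2.2 y hyY hye.symm
  refine ⟨fun u hu => ⟨hu.1, fun hue => he_notMem (hue ▸ hu), fun y hy huy => ?_⟩,
    fun h => (h hd).2.1 rfl⟩
  rcases huy.symm.reaches_first hu.2.1.symm with hyu | hyd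
  · exact hu.2.2 y hy (hyu.symm.mono (Set.sdiff_subset_sdiff_left Set.sdiff_subset))
  · exact hd.2.2 y hy (hyd.symm.mono Set.sdiff_subset)

theorem exists_mem_unseparated [Finite V] (hconn : ∀ u ∈ D, ∀ v ∈ D, ReachIn G D u v)
    (hY : (Y ∩ D).Nonempty) (hv : v ∈ D \ unseparated G D Y) :
    ∃ b ∈ unseparated G D Y, v ∈ separatedBy G D Y b := by
  have hne : {d | d ∈ D ∧ v ∈ separatedBy G D Y d}.Nonempty := by
    by_contra! hempty
    exact hv.2 ⟨hv.1, fun d hd hvd => hempty.subset ⟨hd, hvd⟩⟩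
  obtain ⟨d, ⟨hdD, hvd⟩, hmax⟩ := (Set.toFinite _).exists_maximalFor (separatedBy G D Y) _ hne
  refine ⟨d, ⟨hdD, fun e he hde => ?_⟩, hvd⟩
  have hlt := separatedBy_ssubset hconn hY hde
  exact hlt.2 (hmax ⟨he, hlt.1 hvd⟩ hlt.1)

theorem uniqueAttachment_unseparated [Finite V] (hconn : ∀ u ∈ D, ∀ v ∈ D, ReachIn G D u v)
    (hY : (Y ∩ D).Nonempty) : UniqueAttachment G D (unseparated G D Y) := by
  intro b hb b' hb' u u' hbu hbu' huu'
  obtain ⟨c, hc, huc⟩ := exists_mem_unseparated hconn hY huu'.left_mem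
  have huc' : u' ∈ separatedBy G D Y c :=
    mem_separatedBy_of_reachIn huc
      (huu'.mono (Set.sdiff_subset_sdiff_right (Set.singleton_subset_iff.2 hc)))
  have eq_of_adj : ∀ a ∈ unseparated G D Y, ∀ w ∈ separatedBy G D Y c, G.Adj a w → a = c := by
    intro a ha w hw haw
    by_contra hac
    exact ha.2 c hc.1 (mem_separatedBy_of_reachIn hw
      (.cons ⟨hw.1, hw.2.1⟩ haw.symm (.refl ⟨ha.1, hac⟩)))
  exact (eq_of_adj b hb u huc hbu).trans (eq_of_adj b' hb' u' huc' hbu').symm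

end Separation

/-- The hypothesis on `D`, `X`, `Y` in the inductive proof of the treedepth bound. If a new vertex
is joined to all of `X ∩ D` and `Y ∩ D`, it says essentially that `D` and that vertex induce a
2-connected graph. -/
structure Linked (G : SimpleGraph V) (D X Y : Set V) : Prop where
  left_nonempty : (X ∩ D).Nonempty
  right_nonempty : (Y ∩ D).Nonempty
  reachIn : ∀ u ∈ D, ∀ v ∈ D, ReachIn G D u v
  subset_unseparated : D ⊆ unseparated G D (X ∪ Y)

/-- Every path of `G` from `X` to `Y` inside `D` has at most `L` vertices. -/
def PathBound (G : SimpleGraph V) (D X Y : Set V) (L : ℕ) : Prop :=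
  ∀ ⦃x⦄, x ∈ X → ∀ ⦃y⦄, y ∈ Y → ∀ p : G.Walk x y, p.IsPath → (∀ w ∈ p.support, w ∈ D) →
    p.length < L

section Linked

variable {B C D X Y Z : Set V} {L : ℕ} {b v y z : V}

theorem PathBound.symm (h : PathBound G D X Y L) : PathBound G D Y X L := by
  intro y hy x hx p hp hpD
  simpa using h hx hy p.reverse hp.reverse (by simpa using hpD)

theorem pathBound_natCard [Finite V] : PathBound G D X Y (Nat.card V) := by
  intro x _ y _ p hp _
  have := Fintype.ofFinite V
  simpa using hp.length_lt

theorem Linked.pos_of_pathBound (h : Linked G D X Y) (hL : PathBound G D X Y L) : 0 < L := by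
  obtain ⟨x, hxX, hxD⟩ := h.left_nonempty
  obtain ⟨y, hyY, hyD⟩ := h.right_nonempty
  obtain ⟨p, hp, hpD⟩ := (h.reachIn x hxD y hyD).exists_isPath
  exact (Nat.zero_le _).trans_lt (hL hxX hyY p hp hpD)

theorem isPath_append_cons {a b c d : V} {p : G.Walk a b} {q : G.Walk c d} (hp : p.IsPath)
    (hq : q.IsPath) (hbc : G.Adj b c) (hpq : ∀ x ∈ p.support, x ∉ q.support) :
    (p.append (.cons hbc q)).IsPath := by
  rw [Walk.isPath_def, Walk.support_append, Walk.support_cons, List.tail_cons, List.nodup_append]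
  exact ⟨hp.support_nodup, hq.support_nodup, fun x hx y hy hxy => hpq x hx (hxy ▸ hy)⟩

theorem PathBound.neighborSet (hL : PathBound G D X Y L) (hy : y ∈ Y) {q : G.Walk b y}
    (hq : q.IsPath) (hqD : ∀ w ∈ q.support, w ∈ D) (hCD : C ⊆ D) (hqC : ∀ w ∈ q.support, w ∉ C) :
    PathBound G C X (G.neighborSet b) (L - (q.length + 1)) := by
  intro x hx a hba p hp hpC
  have hlength := hL hx hy (p.append (.cons hba.symm q))
    (isPath_append_cons hp hq hba.symm fun w hwp hwq => hqC w hwq (hpC w hwp)) (by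
      intro w hw
      rw [Walk.support_append, Walk.support_cons, List.tail_cons, List.mem_append] at hw
      exact hw.elim (fun hwp => hCD (hpC w hwp)) (hqD w))
  rw [Walk.length_append, Walk.length_cons] at hlength
  omega

theorem linked_compIn (hconn : ∀ u ∈ D, ∀ v ∈ D, ReachIn G D u v) (hb : b ∈ D) (hv : v ∈ D \ {b})
    (hunsep : compIn G (D \ {b}) v ⊆ unseparated G D (insert b Z)) :
    Linked G (compIn G (D \ {b}) v) Z (G.neighborSet b) where
  left_nonempty := by
    obtain ⟨z, rfl | hz, hvz⟩ := (mem_unseparated_iff.1 (hunsep (.refl hv))).2 b hb hv.2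
    · exact absurd rfl hvz.right_mem.2
    · exact ⟨z, hz, hvz⟩
  right_nonempty := by
    obtain ⟨a, hab, hva⟩ := (hconn v hv.1 b hb).exists_adj hv.2
    exact ⟨a, hab.symm, hva⟩
  reachIn u hu w hw :=
    ((hu.symm.trans hw).inter_compIn subset_rfl hu).mono Set.inter_subset_right
  subset_unseparated := by
    intro u hu
    refine mem_unseparated_iff.2 ⟨hu, fun d hd hud => ?_⟩
    have restrict : ∀ w, ReachIn G ((D \ {d}) \ {b}) u w →
        ReachIn G (compIn G (D \ {b}) v \ {d}) u w := fun w huw =>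
      (huw.inter_compIn (Set.sdiff_subset_sdiff_left Set.sdiff_subset) hu).mono
        fun a ha => ⟨ha.2, ha.1.1.2⟩
    obtain ⟨z, hz, huz⟩ := (mem_unseparated_iff.1 (hunsep hu)).2 d (compIn_subset hd).1 hud
    rcases huz.avoids_or_exists_adj (compIn_subset hu).2 with huz' | ⟨a, hab, hua⟩
    · exact ⟨z, .inl (hz.resolve_left huz'.right_mem.2), restrict z huz'⟩
    · exact ⟨a, .inr hab.symm, restrict a hua⟩

theorem Linked.compIn_of_mem_separatedBy (h : Linked G D X Y) (hb : b ∈ D)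
    (hv : v ∈ separatedBy G D Y b) :
    Linked G (compIn G (D \ {b}) v) X (G.neighborSet b) :=
  linked_compIn h.reachIn hb ⟨hv.1, hv.2.1⟩ fun _ hu =>
    mem_unseparated_insert (mem_separatedBy_of_reachIn hv hu)
      (h.subset_unseparated (compIn_subset hu).1)

theorem linked_unseparated [Finite V] (hconn : ∀ u ∈ D, ∀ v ∈ D, ReachIn G D u v)
    (hY : (Y ∩ D).Nonempty) (hz : z ∈ unseparated G D Y) :
    Linked G (unseparated G D Y) {z} Y where
  left_nonempty := ⟨z, rfl, hz⟩
  right_nonempty := by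
    obtain ⟨y, hy⟩ := hY
    exact ⟨y, hy.1, inter_subset_unseparated hy⟩
  reachIn u hu v hv :=
    ((uniqueAttachment_unseparated hconn hY).reachIn_inter (hconn u hu.1 v hv.1) hu hv).mono
      Set.inter_subset_right
  subset_unseparated := by
    intro v hv
    refine mem_unseparated_iff.2 ⟨hv, fun d hd hvd => ?_⟩
    obtain ⟨y, hyY, hvy⟩ := (mem_unseparated_iff.1 hv).2 d hd.1 hvd
    have hatt : UniqueAttachment G (D \ {d}) (unseparated G D Y) :=
      (uniqueAttachment_unseparated hconn hY).mono subset_rfl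
        (Set.sdiff_subset_sdiff_left Set.sdiff_subset)
    refine ⟨y, .inr hyY, (hatt.reachIn_inter hvy hv ?_).mono fun a ha => ⟨ha.2, ha.1.2⟩⟩
    exact inter_subset_unseparated ⟨hyY, hvy.right_mem.1⟩

theorem exists_treeDepthLE_forall_exists_isPath [Finite V] (hB : B.Nonempty)
    (hlink : ∀ b ∈ B, Linked G B {b} Y)
    (hdepth : ∀ b ∈ B, ∀ L, PathBound G B {b} Y L → TreeDepthLE G B L) :
    ∃ t, TreeDepthLE G B t ∧ ∀ b ∈ B, ∃ y ∈ Y, ∃ q : G.Walk b y,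
      q.IsPath ∧ (∀ w ∈ q.support, w ∈ B) ∧ t ≤ q.length + 1 := by
  classical
  have hex : ∃ t, TreeDepthLE G B t := by
    obtain ⟨b, hb⟩ := hB
    exact ⟨_, hdepth b hb _ pathBound_natCard⟩
  refine ⟨Nat.find hex, Nat.find_spec hex, fun b hb => ?_⟩
  by_contra! hshort
  have hL : PathBound G B {b} Y (Nat.find hex - 1) := by
    rintro _ rfl y hy q hq hqB
    have := hshort y hy q hq hqB
    omega
  have hpos := (hlink b hb).pos_of_pathBound hL
  have hmin := Nat.find_min' hex (hdepth b hb _ hL)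
  omega

theorem Linked.treeDepthLE_of_subset_unseparated (h : Linked G D X Y)
    (hunsep : D ⊆ unseparated G D Y) (hL : PathBound G D X Y L)
    (ih : ∀ C ⊂ D, ∀ X Y L, Linked G C X Y → PathBound G C X Y L → TreeDepthLE G C L) :
    TreeDepthLE G D L := by
  obtain ⟨z, hzX, hzD⟩ := h.left_nonempty
  rw [← Nat.sub_add_cancel (h.pos_of_pathBound hL)]
  refine .remove z (.components fun v hv => ?_)
  refine ih _ (compIn_sdiff_singleton_ssubset hzD) Y (G.neighborSet z) _ ?_ ?_
  · exact linked_compIn h.reachIn hzD hv fun u hu =>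
      unseparated_mono (Set.subset_insert z Y) (hunsep (compIn_subset hu).1)
  · exact hL.symm.neighborSet hzX .nil (by simpa using hzD)
      (compIn_subset.trans Set.sdiff_subset) (by simpa using fun hz => (compIn_subset hz).2 rfl)

theorem Linked.treeDepthLE_of_not_subset_unseparated [Finite V] (h : Linked G D X Y)
    (hsep : ¬ D ⊆ unseparated G D Y) (hL : PathBound G D X Y L)
    (ih : ∀ C ⊂ D, ∀ X Y L, Linked G C X Y → PathBound G C X Y L → TreeDepthLE G C L) :
    TreeDepthLE G D L := by
  set U := unseparated G D Y
  have hlink : ∀ b ∈ U, Linked G U {b} Y :=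
    fun b hb => linked_unseparated h.reachIn h.right_nonempty hb
  obtain ⟨t, htU, hlong⟩ := exists_treeDepthLE_forall_exists_isPath
    (h.right_nonempty.mono inter_subset_unseparated) hlink
    fun b hb L => ih U ⟨unseparated_subset, hsep⟩ _ _ L (hlink b hb)
  have hcomp : ∀ v ∈ D \ U, t ≤ L ∧ TreeDepthLE G (compIn G (D \ U) v) (L - t) := by
    intro v hv
    obtain ⟨b, hbU, hvb⟩ := exists_mem_unseparated h.reachIn h.right_nonempty hv
    have hb : b ∈ D := unseparated_subset hbU
    obtain ⟨y, hy, q, hq, hqU, htq⟩ := hlong b hbU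
    have hlinkC := h.compIn_of_mem_separatedBy hb hvb
    have hLC : PathBound G (compIn G (D \ {b}) v) X (G.neighborSet b) (L - (q.length + 1)) :=
      hL.neighborSet hy hq (fun w hw => (hqU w hw).1) (compIn_subset.trans Set.sdiff_subset)
        fun w hw hvw => (hqU w hw).2 b hb (mem_separatedBy_of_reachIn hvb hvw)
    have hpos := hlinkC.pos_of_pathBound hLC
    refine ⟨by omega, ?_⟩
    exact (ih _ (compIn_sdiff_singleton_ssubset hb) _ _ _ hlinkC hLC).mono
      (compIn_mono (Set.sdiff_subset_sdiff_right (Set.singleton_subset_iff.2 hbU))) (by omega)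
  obtain ⟨v, hv⟩ := Set.sdiff_nonempty.2 hsep
  rw [← Nat.add_sub_cancel' (hcomp v hv).1]
  exact htU.attach (uniqueAttachment_unseparated h.reachIn h.right_nonempty)
    fun v hv => (hcomp v hv).2

theorem Linked.treeDepthLE [Finite V] (h : Linked G D X Y) (hL : PathBound G D X Y L) :
    TreeDepthLE G D L := by
  induction D using WellFoundedLT.induction generalizing X Y L with
  | ind D ih =>
    by_cases hunsep : D ⊆ unseparated G D Y
    · exact h.treeDepthLE_of_subset_unseparated hunsep hL fun C hC _ _ _ => ih C hC
    · exact h.treeDepthLE_of_not_subset_unseparated hunsep hL fun C hC _ _ _ => ih C hC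

end Linked

/-- The restriction of `φ` to `S` is a proper colouring of the subgraph of `G` induced on `S`; the
values of `φ` outside `S` are irrelevant. -/
def ProperOn (G : SimpleGraph V) (S : Set V) {α : Type*} (φ : V → α) : Prop :=
  ∀ ⦃u⦄, u ∈ S → ∀ ⦃v⦄, v ∈ S → G.Adj u v → φ u ≠ φ v

section Counting

variable {A D S T : Set V} {m t : ℕ}

theorem ProperOn.mono {α : Type*} {φ : V → α} (h : ProperOn G T φ) (hST : S ⊆ T) :
    ProperOn G S φ :=
  fun _ hu _ hv => h (hST hu) (hST hv)

theorem exists_adj_eq_of_not_colorable (hG : ¬ G.Colorable m) {f g : V → Fin m}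
    (hf : ProperOn G A f) (hg : ProperOn G Aᶜ g) : ∃ x ∈ A, ∃ y ∉ A, G.Adj x y ∧ f x = g y := by
  classical
  by_contra! hcross
  refine hG ⟨Coloring.mk (fun x => if x ∈ A then f x else g x) fun {x y} hxy => ?_⟩
  by_cases hx : x ∈ A <;> by_cases hy : y ∈ A <;> simp only [hx, hy, if_true, if_false]
  · exact hf hx hy hxy
  · exact hcross x hx y hy hxy
  · exact (hcross y hy x hx hxy.symm).symm
  · exact hg hx hy hxy

theorem mem_compIn_of_agree (hG : ¬ G.Colorable m) {φ : V → V → Fin m}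
    (hφ : ∀ w, ProperOn G {w}ᶜ (φ w)) {w w' : V} (hw : w ∈ D) (hw' : w' ∈ D)
    (hagree : ∀ x ∉ D, (∃ u ∈ D, G.Adj u x) → φ w x = φ w' x) : w' ∈ compIn G D w := by
  by_contra hww'
  obtain ⟨x, hx, y, hy, hxy, heq⟩ := exists_adj_eq_of_not_colorable hG (A := compIn G D w)
    ((hφ w').mono fun x hx => ne_of_mem_of_not_mem hx hww')
    ((hφ w).mono fun y hy => (ne_of_mem_of_not_mem (ReachIn.refl hw) hy).symm)
  have hyD : y ∉ D := fun hyD => hy (ReachIn.trans hx (.cons hx.right_mem hxy (.refl hyD)))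
  rw [hagree y hyD ⟨x, hx.right_mem, hxy⟩] at heq
  exact hφ w' (ne_of_mem_of_not_mem hx hww') (ne_of_mem_of_not_mem hw' hyD).symm hxy heq

theorem TreeDepthLE.card_le (hD : TreeDepthLE G D t) (hG : ¬ G.Colorable m) {φ : V → V → Fin m}
    (hφ : ∀ w, ProperOn G {w}ᶜ (φ w)) (W : Finset V) (hW : ↑W ⊆ D)
    (hagree : ∀ w ∈ W, ∀ w' ∈ W, ∀ x ∉ D, (∃ u ∈ D, G.Adj u x) → φ w x = φ w' x) :
    W.card ≤ ∑ i ∈ Finset.range t, m ^ i := by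
  classical
  induction hD generalizing W with
  | components _ ih =>
    obtain rfl | ⟨w₀, hw₀⟩ := W.eq_empty_or_nonempty
    · exact Nat.zero_le _
    refine ih w₀ (hW hw₀) W
      (fun w hw => mem_compIn_of_agree hG hφ (hW hw₀) (hW hw) (hagree w₀ hw₀ w hw)) ?_
    rintro w hw w' hw' x hx ⟨u, hu, hux⟩
    refine hagree w hw w' hw' x (fun hxD => hx ?_) ⟨u, hu.right_mem, hux⟩
    exact ReachIn.trans hu (.cons hu.right_mem hux (.refl hxD))
  | @remove D t v _ ih =>
    have hclass : ∀ c ∈ Finset.univ, ((W.erase v).filter fun w => φ w v = c).card ≤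
        ∑ i ∈ Finset.range t, m ^ i := by
      intro c _
      refine ih _ (fun w hw => ?_) fun w hw w' hw' x hx hux => ?_
      · simp only [Finset.coe_filter, Finset.mem_erase, Set.mem_ofPred_eq] at hw
        exact ⟨hW hw.1.2, hw.1.1⟩
      · simp only [Finset.mem_filter, Finset.mem_erase] at hw hw'
        by_cases hxv : x = v
        · rw [hxv, hw.2, hw'.2]
        · obtain ⟨u, hu, hux⟩ := hux
          exact hagree w hw.1.2 w' hw'.1.2 x (fun hxD => hx ⟨hxD, hxv⟩) ⟨u, hu.1, hux⟩
    calc W.card ≤ (W.erase v).card + 1 := Nat.sub_le_iff_le_add.1 W.pred_card_le_card_erase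
      _ ≤ (∑ i ∈ Finset.range t, m ^ i) * (Finset.univ : Finset (Fin m)).card + 1 := by
        gcongr
        exact Finset.card_le_mul_card_image_of_maps_to (by simp) _ hclass
      _ = ∑ i ∈ Finset.range (t + 1), m ^ i := by
        rw [geom_sum_succ, Finset.card_fin, mul_comm]

end Counting

section Critical

variable {k : ℕ} {d u v x y : V}

theorem exists_properOn_compl (h : G.IsCritical k) (hk : 2 ≤ k) {W : Set V} (hW : W.Nonempty) :
    ∃ φ : V → Fin (k - 1), ProperOn G Wᶜ φ := by
  classical
  have hmem : ∀ {v}, v ∈ Wᶜ → v ∈ ((⊤ : G.Subgraph).deleteVerts W).verts := fun hv => ⟨trivial, hv⟩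
  have hproper : (⊤ : G.Subgraph).deleteVerts W ≠ ⊤ := by
    obtain ⟨w, hw⟩ := hW
    intro htop
    have hw' : w ∈ ((⊤ : G.Subgraph).deleteVerts W).verts := by rw [htop]; trivial
    exact hw'.2 hw
  obtain ⟨C⟩ := h.1 _ hproper
  refine ⟨fun v => if hv : v ∈ Wᶜ then C ⟨v, hmem hv⟩ else ⟨0, by omega⟩, fun u hu v hv huv => ?_⟩
  simp only [dif_pos hu, dif_pos hv]
  exact C.valid (by simpa using ⟨hu, hv, huv⟩)

theorem le_enatCard (h : G.IsCritical k) : k ≤ ENat.card V := by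
  rcases finite_or_infinite V with hV | hV
  · have := Fintype.ofFinite V
    rw [ENat.card_eq_coe_fintype_card, Nat.cast_le]
    by_contra! hlt
    exact h.2 (G.colorable_of_fintype.mono (Nat.le_sub_one_of_lt hlt))
  · rw [ENat.card_eq_top_of_infinite]
    exact le_top

theorem exists_adj (h : G.IsCritical k) (hk : 2 ≤ k) : ∃ x y, G.Adj x y := by
  by_contra! hadj
  exact h.2 ⟨Coloring.mk (fun _ => ⟨0, by omega⟩) fun hxy => absurd hxy (hadj _ _)⟩

theorem exists_ne_ne (h : G.IsCritical k) (hk : 3 ≤ k) (x y : V) :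
    ∃ z, z ≠ x ∧ z ≠ y :=
  ENat.exists_ne_ne_of_three_le (le_trans (mod_cast hk) (le_enatCard h)) x y

theorem reachIn_sdiff_singleton (h : G.IsCritical k) (hk : 2 ≤ k) (hu : u ≠ d) (hv : v ≠ d) :
    ReachIn G (Set.univ \ {d}) u v := by
  by_contra hnreach
  set A := compIn G (Set.univ \ {d}) u
  have huA : u ∈ A := .refl ⟨trivial, hu⟩
  have hdA : d ∉ A := fun hd => (compIn_subset hd).2 rfl
  obtain ⟨φ, hφ⟩ := exists_properOn_compl h hk ⟨u, huA⟩
  obtain ⟨χ, hχ⟩ := exists_properOn_compl h hk (W := (insert d A)ᶜ)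
    ⟨v, fun hvA => hvA.elim hv hnreach⟩
  rw [compl_compl] at hχ
  -- Permuting colours makes the two colourings agree at `d`.
  let σ := Equiv.swap (χ d) (φ d)
  obtain ⟨x, hx, y, hy, hxy, heq⟩ := exists_adj_eq_of_not_colorable h.2 (f := σ ∘ χ)
    (fun a ha b hb hab => σ.injective.ne (hχ (.inr ha) (.inr hb) hab)) hφ
  obtain rfl : y = d := by
    by_contra hyd
    exact hy (ReachIn.trans hx (.cons (compIn_subset hx) hxy (.refl ⟨trivial, hyd⟩)))
  exact hχ (.inr hx) (.inl rfl) hxy (σ.injective (heq.trans (Equiv.swap_apply_left _ _).symm))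

theorem linked_univ (h : G.IsCritical k) (hk : 3 ≤ k) (hxy : x ≠ y) :
    Linked G Set.univ {x} {y} where
  left_nonempty := ⟨x, rfl, trivial⟩
  right_nonempty := ⟨y, rfl, trivial⟩
  reachIn := by
    intro u _ v _
    obtain ⟨d, hdu, hdv⟩ := exists_ne_ne h hk u v
    exact (reachIn_sdiff_singleton h (by omega) hdu.symm hdv.symm).mono Set.sdiff_subset
  subset_unseparated := by
    intro v _
    refine mem_unseparated_iff.2 ⟨trivial, fun d _ hvd => ?_⟩
    by_cases hxd : x = d
    · exact ⟨y, .inr rfl, reachIn_sdiff_singleton h (by omega) hvd (hxd ▸ hxy.symm)⟩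
    · exact ⟨x, .inl rfl, reachIn_sdiff_singleton h (by omega) hvd hxd⟩

theorem exists_isPath_two_le_length (h : G.IsCritical k) (hk : 3 ≤ k) (hxy : x ≠ y) :
    ∃ p : G.Walk x y, p.IsPath ∧ 2 ≤ p.length := by
  obtain ⟨z, hzx, hzy⟩ := exists_ne_ne h hk x y
  obtain ⟨a, hax, hza⟩ := (reachIn_sdiff_singleton h (by omega) hzy hxy).exists_adj hzx
  obtain ⟨p, hp, hpx⟩ :=
    (reachIn_sdiff_singleton h (by omega) hax.ne hxy.symm).exists_isPath
  refine ⟨.cons hax.symm p, hp.cons fun hx => (hpx x hx).2 rfl, ?_⟩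
  have hpos : p.length ≠ 0 := fun h0 => hza.right_mem.1.2 (Walk.eq_of_length_eq_zero h0)
  rw [Walk.length_cons]
  omega

theorem card_lt_of_treeDepthLE [Fintype V] {t : ℕ} (h : G.IsCritical k) (hk : 3 ≤ k)
    (ht : TreeDepthLE G Set.univ t) : Fintype.card V < (k - 1) ^ t := by
  choose φ hφ using fun w : V => exists_properOn_compl h (by omega) (Set.singleton_nonempty w)
  calc Fintype.card V ≤ ∑ i ∈ Finset.range t, (k - 1) ^ i :=
        ht.card_le h.2 hφ Finset.univ (Set.subset_univ _) fun _ _ _ _ _ hx => absurd trivial hx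
    _ < (k - 1) ^ t := Nat.geomSum_lt (by omega) fun _ => Finset.mem_range.1

theorem exists_isCycle_card_lt_pow [Fintype V] (h : G.IsCritical k) (hk : 3 ≤ k) :
    ∃ (v : V) (c : G.Walk v v), c.IsCycle ∧ Fintype.card V < (k - 1) ^ c.length := by
  classical
  obtain ⟨x, y, hxy⟩ := exists_adj h (by omega)
  obtain ⟨q, hq, hq2⟩ := exists_isPath_two_le_length h hk hxy.ne
  have : Nonempty (G.Path x y) := ⟨⟨q, hq⟩⟩
  obtain ⟨⟨p, hp⟩, hmax⟩ := Finite.exists_max fun p : G.Path x y => p.1.length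
  have hp2 : 2 ≤ p.length := hq2.trans (hmax ⟨q, hq⟩)
  have hbound : PathBound G Set.univ {x} {y} (p.length + 1) := by
    rintro _ rfl _ rfl r hr -
    exact Nat.lt_succ_of_le (hmax ⟨r, hr⟩)
  refine ⟨y, .cons hxy.symm p, (Walk.cons_isCycle_iff p hxy.symm).2 ⟨hp, fun hmem => ?_⟩, ?_⟩
  · have := hp.length_eq_one_of_mem_edges (Sym2.eq_swap ▸ hmem)
    omega
  · exact card_lt_of_treeDepthLE h hk ((linked_univ h hk hxy.ne).treeDepthLE hbound)

theorem exists_isCycle_logb_le [Fintype V] (h : G.IsCritical k) (hk : 3 ≤ k) :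
    ∃ (v : V) (c : G.Walk v v), c.IsCycle ∧
      Real.logb (k - 1) (Fintype.card V) ≤ (c.length : ℝ) := by
  obtain ⟨v, c, hc, hlt⟩ := exists_isCycle_card_lt_pow h hk
  have hcard : (Fintype.card V : ℝ) ≤ ((k : ℝ) - 1) ^ c.length := by
    rw [← Nat.cast_pred (by omega)]
    exact mod_cast hlt.le
  have hpos : 0 < Fintype.card V := Fintype.card_pos_iff.2 ⟨v⟩
  have hk1 : 1 < (k : ℝ) - 1 := by
    have : (3 : ℝ) ≤ k := mod_cast hk
    linarith
  refine ⟨v, c, hc, (Real.logb_le_iff_le_rpow hk1 (mod_cast hpos)).2 ?_⟩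
  rwa [Real.rpow_natCast]

theorem coe_le_minCriticalCircumference {n : ℕ} {r : ℝ}
    (h : ∀ G : SimpleGraph (Fin n), G.IsCritical k →
      ∃ (v : Fin n) (c : G.Walk v v), c.IsCycle ∧ r ≤ (c.length : ℝ)) :
    (r : EReal) ≤ ((minCriticalCircumference k n : ENNReal) : EReal) := by
  have hceil : (⌈r⌉₊ : ℕ∞) ≤ minCriticalCircumference k n := by
    refine le_sSup fun G hG => ?_
    obtain ⟨v, c, hc, hr⟩ := h G hG
    exact le_iSup_of_le v <| le_iSup_of_le c <| le_iSup_of_le hc <| mod_cast Nat.ceil_le.2 hr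
  calc (r : EReal) ≤ ((⌈r⌉₊ : ℝ) : EReal) := mod_cast Nat.le_ceil r
    _ = (((⌈r⌉₊ : ℕ∞) : ENNReal) : EReal) := by
      rw [ENat.toENNReal_coe]
      exact (EReal.coe_nnreal_eq_coe_real (⌈r⌉₊ : NNReal)).symm
    _ ≤ _ := mod_cast hceil

theorem log_div_le_logb_pred (hk : 3 ≤ k) (n : ℕ) :
    Real.log n / (100 * Real.log k) ≤ Real.logb (k - 1) n := by
  have hk3 : (3 : ℝ) ≤ k := mod_cast hk
  have hpos : 0 < Real.log (k - 1) := Real.log_pos (by linarith)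
  have hle : Real.log (k - 1) ≤ Real.log k := Real.log_le_log (by linarith) (by linarith)
  exact div_le_div_of_nonneg_left (Real.log_natCast_nonneg n) hpos (by linarith)

end Critical

end CriticalGraph

theorem theorem1p1_general (k n : ℕ) (hk : 3 ≤ k) :
    (∀ (V : Type*) [Fintype V] (G : SimpleGraph V), Fintype.card V = n → G.IsCritical k →
      ∃ (v : V) (c : G.Walk v v), c.IsCycle ∧ Real.logb (k - 1) n ≤ (c.length : ℝ)) ∧
    (Real.logb (k - 1) n : EReal) ≤
      ((SimpleGraph.minCriticalCircumference k n : ENNReal) : EReal) := by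
  refine ⟨fun V _ G hV hG => ?_, CriticalGraph.coe_le_minCriticalCircumference fun G hG => ?_⟩
  · exact hV ▸ CriticalGraph.exists_isCycle_logb_le hG hk
  · simpa only [Fintype.card_fin] using CriticalGraph.exists_isCycle_logb_le hG hk

theorem theorem1p1 (k n : ℕ) (hk : 4 ≤ k) (hn : k + 2 ≤ n) :
    (∀ (V : Type*) [Fintype V] (G : SimpleGraph V), Fintype.card V = n → G.IsCritical k →
      ∃ (v : V) (c : G.Walk v v), c.IsCycle ∧
        Real.log n / (100 * Real.log k) ≤ (c.length : ℝ)) ∧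
    ((Real.log n / (100 * Real.log k) : ℝ) : EReal) ≤
      ((SimpleGraph.minCriticalCircumference k n : ENNReal) : EReal) := by
  have hlog := CriticalGraph.log_div_le_logb_pred (by omega : 3 ≤ k) n
  obtain ⟨hcycle, hmin⟩ := theorem1p1_general k n (by omega)
  refine ⟨fun V _ G hV hG => ?_, (EReal.coe_le_coe hlog).trans hmin⟩
  obtain ⟨v, c, hc, hle⟩ := hcycle V G hV hG
  exact ⟨v, c, hc, hlog.trans hle⟩
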